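/- Let $\tilde G$ be the universal covering group of the group of Möbius transformations of the unit disc $\mathbb D$; for $g\in\tilde G$ acting by $z\mapsto (az+b)(cz+d)^{-1}$ with $\begin{pmatrix}a&b\\c&d\end{pmatrix}\in SU(1,1)$ put $c_g=c$ (the analytic function on $\tilde G$ which agrees with $c$ near the identity), and for real $s$ let $(g')(z)^s$ be the continuous branch on $\tilde G\times\mathbb D$ which equals $1$ at $g=e$. A homogeneous holomorphic vector bundle over $\mathbb D$ is a holomorphic vector bundle with an action of $\tilde G$ on it by holomorphic bundle maps covering the action on $\mathbb D$; two such bundles are isomorphic, written $E\equiv E'$, if there is a $\tilde G$-equivariant isomorphism of holomorphic vector bundles over the identity of $\mathbb D$. Let $\eta\in\mathbb R$, $m\ge 0$, $\mathbb C^n=\mathbb C^{d_0}\oplus\cdots\oplus\mathbb C^{d_m}$ with $d_0,d_m\geq 1$ (and $d_j\ge 0$ for $0<j<m$), and let $Y$ be an $n\times n$ matrix whose only possibly nonzero blocks are the subdiagonal ones $Y_j:\mathbb C^{d_{j-1}}\to\mathbb C^{d_j}$, $1\le j\le m$. The elementary bundle $E^{(\eta,Y)}$ is the trivial holomorphic bundle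 $\mathbb D\times\mathbb C^n$ on whose sections $\tilde G$ acts by $f\mapsto J^{(\eta,Y)}_{g^{-1}}\,(f\circ g^{-1})$, where the $(p,\ell)$ block of the multiplier is $$\big(J^{(\eta,Y)}_g(z)\big)_{p,\ell}=\frac{1}{(p-\ell)!}(-c_g)^{p-\ell}\,(g')(z)^{\eta+\frac{p+\ell}{2}}\,Y_p\cdots Y_{\ell+1}\quad (p\ge \ell),\qquad \big(J^{(\eta,Y)}_g(z)\big)_{p,\ell}=0\quad (p<\ell).$$ Proposition. If $E^{(\eta,Y)}\equiv E^{(\eta',Y')}$, then the block formats $(m;d_0,\dots,d_m)$ and $(m';d'_0,\dots,d'_{m'})$ coincide. For $Y,Y'$ of the same block format, $E^{(\eta,Y)}\equiv E^{(\eta',Y')}$ if and only if $\eta=\eta'$ and $Y'=AYA^{-1}$ for some invertible block diagonal matrix $A$ (with diagonal blocks of sizes $d_0,\dots,d_m$). -/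

import Mathlib

open Complex
open scoped ComplexConjugate Complex.UnitDisc

noncomputable section

namespace DiscBundle

/-! ### Holomorphic functions on the disc -/

/-- A function on the open unit disc is holomorphic. -/
def IsHolomorphic (f : 𝔻 → ℂ) : Prop :=
  ∃ F : ℂ → ℂ, DifferentiableOn ℂ F (Metric.ball 0 1) ∧ ∀ z : 𝔻, f z = F z

theorem IsHolomorphic.continuous {f : 𝔻 → ℂ} (hf : IsHolomorphic f) : Continuous f := by
  obtain ⟨F, hF, h⟩ := hf
  have : f = fun z : 𝔻 => F z := funext h
  rw [this]
  exact hF.continuousOn.comp_continuous UnitDisc.continuous_coe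
    (fun z => by simpa using z.norm_lt_one)

/-! ### The Moebius transformations `z ↦ (a z + b) / (c z + d)` with
`a = conj d`, `b = conj c`, `|d|² - |c|² = 1` -/

theorem denom_ne_zero {c d : ℂ} (h : normSq d - normSq c = 1) (z : 𝔻) :
    c * z + d ≠ 0 := by
  intro h0
  have h1 : normSq d = normSq c * normSq (z : ℂ) := by
    rw [← normSq_mul, ← normSq_neg d]
    congr 1
    linear_combination -h0
  nlinarith [z.normSq_lt_one, normSq_nonneg c, normSq_nonneg (z : ℂ)]

theorem moebius_norm_lt_one {c d : ℂ} (h : normSq d - normSq c = 1) (z : 𝔻) :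
    ‖(conj d * z + conj c) / (c * z + d)‖ < 1 := by
  have h0 := denom_ne_zero h z
  rw [norm_div, div_lt_one (norm_pos_iff.2 h0)]
  refine lt_of_pow_lt_pow_left₀ 2 (norm_nonneg _) ?_
  rw [← normSq_eq_norm_sq, ← normSq_eq_norm_sq]
  have key : normSq (c * z + d) - normSq (conj d * z + conj c)
      = (normSq d - normSq c) * (1 - normSq (z : ℂ)) := by
    simp only [normSq_apply, add_re, mul_re, add_im, mul_im, conj_re, conj_im]
    ring
  rw [h] at key
  linarith [z.normSq_lt_one]

theorem IsHolomorphic.comp_moebius {c d : ℂ} (h : normSq d - normSq c = 1) {f : 𝔻 → ℂ}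
    (hf : IsHolomorphic f) :
    IsHolomorphic (fun z => f (UnitDisc.mk ((conj d * z + conj c) / (c * z + d))
      (moebius_norm_lt_one h z))) := by
  obtain ⟨F, hF, hf⟩ := hf
  refine ⟨fun z => F ((conj d * z + conj c) / (c * z + d)), ?_, fun z => hf _⟩
  refine hF.comp (t := Metric.ball (0 : ℂ) 1) ?_ ?_
  · intro z hz
    have hz' : ‖z‖ < 1 := by simpa using hz
    have h0 := denom_ne_zero h (UnitDisc.mk z hz')
    rw [UnitDisc.coe_mk] at h0
    have h1 : DifferentiableAt ℂ (fun z : ℂ => conj d * z + conj c) z :=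
      (differentiableAt_id.const_mul _).add_const _
    have h2 : DifferentiableAt ℂ (fun z : ℂ => c * z + d) z :=
      (differentiableAt_id.const_mul _).add_const _
    exact (h1.div h2 h0).differentiableWithinAt
  · intro z hz
    have hz' : ‖z‖ < 1 := by simpa using hz
    simpa using moebius_norm_lt_one h (UnitDisc.mk z hz')

/-- The universal covering group of the Moebius group of the unit disc. An element is a
matrix in `SU(1,1)`, with rows `(conj d, conj c)` and `(c, d)`, together with a holomorphic
branch `log` of `log (c z + d)` on the disc. Since `log` is determined by `c` and
`w = log 0` with `exp w = d`, as a space this is `{(c, w) : exp (2 Re w) = 1 + |c|²}`, which is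
homeomorphic to `ℂ × ℝ` and so simply connected; the kernel of the projection to the
Moebius group is the discrete group of the elements `c = 0`, `d = ± 1`, `log = k π i`,
`k ∈ ℤ`. -/
@[ext]
structure MoebiusCover where
  c : ℂ
  d : ℂ
  log : 𝔻 → ℂ
  det_eq_one : normSq d - normSq c = 1
  holomorphic_log : IsHolomorphic log
  exp_log : ∀ z : 𝔻, exp (log z) = c * z + d

namespace MoebiusCover

/-- The action on the disc, `z ↦ (a z + b) / (c z + d)`. -/
def app (g : MoebiusCover) (z : 𝔻) : 𝔻 :=
  UnitDisc.mk ((conj g.d * z + conj g.c) / (g.c * z + g.d)) (moebius_norm_lt_one g.det_eq_one z)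

theorem coe_app (g : MoebiusCover) (z : 𝔻) :
    (g.app z : ℂ) = (conj g.d * z + conj g.c) / (g.c * z + g.d) := rfl

theorem den_ne_zero (g : MoebiusCover) (z : 𝔻) : g.c * z + g.d ≠ 0 :=
  denom_ne_zero g.det_eq_one z

theorem det_eq (g : MoebiusCover) : g.d * conj g.d - g.c * conj g.c = 1 := by
  rw [mul_conj, mul_conj]
  exact_mod_cast congrArg (fun x : ℝ => (x : ℂ)) g.det_eq_one

theorem app_mul_den (g : MoebiusCover) (z : 𝔻) :
    (g.app z : ℂ) * (g.c * z + g.d) = conj g.d * z + conj g.c := by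
  rw [coe_app, div_mul_cancel₀ _ (g.den_ne_zero z)]

/-- The identity, with the branch `log = 0`. -/
instance : One MoebiusCover where
  one :=
    { c := 0
      d := 1
      log := fun _ => 0
      det_eq_one := by simp
      holomorphic_log := ⟨fun _ => 0, by fun_prop, fun _ => rfl⟩
      exp_log := by simp }

theorem app_one (z : 𝔻) : (1 : MoebiusCover).app z = z := by
  apply UnitDisc.coe_injective
  rw [coe_app]
  simp [show (1 : MoebiusCover).c = 0 from rfl, show (1 : MoebiusCover).d = 1 from rfl]

/-- The matrix product, with the branch `log_{gh}(z) = log_g (h z) + log_h z`. -/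
instance : Mul MoebiusCover where
  mul g h :=
    { c := g.c * conj h.d + g.d * h.c
      d := g.c * conj h.c + g.d * h.d
      log := fun z => g.log (h.app z) + h.log z
      det_eq_one := by
        have hg := g.det_eq_one
        have hh := h.det_eq_one
        have : normSq (g.c * conj h.c + g.d * h.d) - normSq (g.c * conj h.d + g.d * h.c)
            = (normSq g.d - normSq g.c) * (normSq h.d - normSq h.c) := by
          simp only [normSq_apply, add_re, mul_re, add_im, mul_im, conj_re, conj_im]
          ring
        rw [this, hg, hh, one_mul]
      holomorphic_log := by
        obtain ⟨F, hF, h1⟩ := g.holomorphic_log.comp_moebius h.det_eq_one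
        obtain ⟨F', hF', h2⟩ := h.holomorphic_log
        exact ⟨fun z => F z + F' z, hF.add hF', fun z => congrArg₂ (· + ·) (h1 z) (h2 z)⟩
      exp_log := by
        intro z
        rw [Complex.exp_add, g.exp_log, h.exp_log]
        linear_combination g.c * h.app_mul_den z }

theorem mul_c (g h : MoebiusCover) : (g * h).c = g.c * conj h.d + g.d * h.c := rfl
theorem mul_d (g h : MoebiusCover) : (g * h).d = g.c * conj h.c + g.d * h.d := rfl
theorem mul_log (g h : MoebiusCover) (z : 𝔻) :
    (g * h).log z = g.log (h.app z) + h.log z := rfl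

theorem app_mul (g h : MoebiusCover) (z : 𝔻) : (g * h).app z = g.app (h.app z) := by
  apply UnitDisc.coe_injective
  have h1 := (g * h).den_ne_zero z
  have h2 := g.den_ne_zero (h.app z)
  rw [coe_app, coe_app g, div_eq_div_iff h1 h2, mul_c, mul_d]
  simp only [map_add, map_mul, conj_conj]
  linear_combination (-(g.d * conj g.d - g.c * conj g.c)) * h.app_mul_den z

/-- The element with the inverse matrix `z ↦ (d z - b) / (-c z + a)`, used to define the
branch of the inverse. -/
def invApp (g : MoebiusCover) (z : 𝔻) : 𝔻 :=
  UnitDisc.mk ((conj (conj g.d) * z + conj (-g.c)) / (-g.c * z + conj g.d))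
    (moebius_norm_lt_one (by simpa using g.det_eq_one) z)

theorem invApp_mul_den (g : MoebiusCover) (z : 𝔻) :
    (g.invApp z : ℂ) * (-g.c * z + conj g.d) = g.d * z - conj g.c := by
  rw [invApp, UnitDisc.coe_mk, div_mul_cancel₀ _
    (denom_ne_zero (by simpa using g.det_eq_one) z)]
  simp only [conj_conj, map_neg]
  ring

theorem app_invApp (g : MoebiusCover) (z : 𝔻) : g.app (g.invApp z) = z := by
  apply UnitDisc.coe_injective
  rw [coe_app, div_eq_iff (g.den_ne_zero (g.invApp z))]
  linear_combination g.invApp_mul_den z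

theorem invApp_app (g : MoebiusCover) (z : 𝔻) : g.invApp (g.app z) = z := by
  apply UnitDisc.coe_injective
  have h0 : -g.c * (g.app z) + conj g.d ≠ 0 := denom_ne_zero (by simpa using g.det_eq_one) _
  rw [invApp, UnitDisc.coe_mk, div_eq_iff h0]
  simp only [conj_conj, map_neg]
  linear_combination g.app_mul_den z

/-- The inverse matrix, with the branch `log_{g⁻¹}(z) = - log_g (g⁻¹ z)`. -/
instance : Inv MoebiusCover where
  inv g :=
    { c := -g.c
      d := conj g.d
      log := fun z => -g.log (g.invApp z)
      det_eq_one := by simpa using g.det_eq_one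
      holomorphic_log := by
        obtain ⟨F, hF, h⟩ := g.holomorphic_log.comp_moebius
          (show normSq (conj g.d) - normSq (-g.c) = 1 by simpa using g.det_eq_one)
        exact ⟨fun z => -F z, hF.neg, fun z => congrArg (fun x => -x) (h z)⟩
      exp_log := by
        intro z
        rw [Complex.exp_neg, g.exp_log]
        refine inv_eq_of_mul_eq_one_right ?_
        linear_combination g.c * g.invApp_mul_den z + g.det_eq }

theorem inv_c (g : MoebiusCover) : g⁻¹.c = -g.c := rfl
theorem inv_d (g : MoebiusCover) : g⁻¹.d = conj g.d := rfl

instance : Group MoebiusCover where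
  mul_assoc f g h := by
    ext z
    · simp only [mul_c, mul_d, map_add, map_mul, conj_conj]; ring
    · simp only [mul_c, mul_d, map_add, map_mul, conj_conj]; ring
    · simp only [mul_log, app_mul]; ring
  one_mul g := by
    ext z
    · rw [mul_c]; change 0 * _ + 1 * _ = _; ring
    · rw [mul_d]; change 0 * _ + 1 * _ = _; ring
    · rw [mul_log]; change 0 + _ = _; ring
  mul_one g := by
    ext z
    · rw [mul_c]; change _ * conj 1 + _ * 0 = _; simp
    · rw [mul_d]; change _ * conj 0 + _ * 1 = _; simp
    · rw [mul_log, app_one]; change _ + 0 = _; ring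
  inv_mul_cancel g := by
    ext z
    · rw [mul_c, inv_c, inv_d]; change _ = 0; ring
    · rw [mul_d, inv_c, inv_d]; change _ = 1; linear_combination g.det_eq
    · rw [mul_log]
      change -g.log (g.invApp (g.app z)) + g.log z = 0
      rw [invApp_app]; ring

/-- The action of the universal covering group on the disc. -/
instance : MulAction MoebiusCover 𝔻 where
  smul g z := g.app z
  one_smul := app_one
  mul_smul := app_mul

/-- The data of an element, as a point of a topological space. -/
def toData (g : MoebiusCover) : (ℂ × ℂ) × C(𝔻, ℂ) :=
  ((g.c, g.d), ⟨g.log, g.holomorphic_log.continuous⟩)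

/-- The topology of the covering group: convergence of the matrix, and locally uniform
convergence of the branch of `log (c z + d)`. -/
instance : TopologicalSpace MoebiusCover :=
  TopologicalSpace.induced toData inferInstance

theorem continuous_toData : Continuous toData := continuous_induced_dom

/-- The branch `(g'(z)) ^ s` of the power of the derivative `g'(z) = (c z + d)⁻²`, which is
`1` at the identity. -/
def derivPow (g : MoebiusCover) (s : ℝ) (z : 𝔻) : ℂ :=
  exp (-2 * (s : ℂ) * g.log z)

theorem continuous_c : Continuous (fun g : MoebiusCover => g.c) :=
  (continuous_fst.comp continuous_fst).comp continuous_toData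

theorem continuous_log : Continuous (fun q : MoebiusCover × 𝔻 => q.1.log q.2) := by
  have ho : Topology.IsOpenEmbedding ((↑) : 𝔻 → ℂ) := by
    refine ⟨UnitDisc.isEmbedding_coe, ?_⟩
    have : Set.range ((↑) : 𝔻 → ℂ) = Metric.ball 0 1 := by
      ext z
      constructor
      · rintro ⟨w, rfl⟩
        simpa using w.norm_lt_one
      · intro hz
        exact ⟨UnitDisc.mk z (by simpa using hz), rfl⟩
    rw [this]
    exact Metric.isOpen_ball
  have : LocallyCompactSpace 𝔻 := ho.locallyCompactSpace
  have h1 : Continuous (fun g : MoebiusCover =>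
      (⟨g.log, g.holomorphic_log.continuous⟩ : C(𝔻, ℂ))) :=
    continuous_snd.comp continuous_toData
  have h2 : Continuous (fun q : C(𝔻, ℂ) × 𝔻 => q.1 q.2) := ContinuousEval.continuous_eval
  exact h2.comp ((h1.comp continuous_fst).prodMk continuous_snd)

end MoebiusCover

/-! ### Homogeneous holomorphic vector bundles -/

/-- A homogeneous holomorphic vector bundle over the disc, given in a global holomorphic
trivialization `𝔻 × ℂ^ι` by its multiplier `J`: the group acts on holomorphic sections by
`f ↦ J g⁻¹ · (f ∘ g⁻¹)`. -/
structure HomogeneousBundle (ι : Type) [Fintype ι] [DecidableEq ι] where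
  J : MoebiusCover → 𝔻 → Matrix ι ι ℂ
  holomorphic : ∀ g p l, IsHolomorphic (fun z => J g z p l)
  continuous : Continuous (fun q : MoebiusCover × 𝔻 => J q.1 q.2)
  J_one : ∀ z, J 1 z = 1
  J_mul : ∀ g h z, J (g * h) z = J h z * J g (h • z)

/-- The action of the group on the total space: `g` maps the vector `ξ` over `z` to the
vector `J g⁻¹ (g z) ξ` over `g z`. -/
def HomogeneousBundle.act {ι : Type} [Fintype ι] [DecidableEq ι] (E : HomogeneousBundle ι)
    (g : MoebiusCover) (v : 𝔻 × (ι → ℂ)) : 𝔻 × (ι → ℂ) :=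
  (g • v.1, (E.J g⁻¹ (g • v.1)).mulVec v.2)

/-- Isomorphism of homogeneous holomorphic vector bundles: there is a holomorphic vector
bundle map `Φ` over the identity of the disc, with a holomorphic inverse `Ψ`, which commutes
with the actions of the group on the total spaces. -/
def HomogeneousBundle.Isomorphic {ι κ : Type} [Fintype ι] [DecidableEq ι] [Fintype κ]
    [DecidableEq κ] (E : HomogeneousBundle ι) (E' : HomogeneousBundle κ) : Prop :=
  ∃ (Φ : 𝔻 → Matrix κ ι ℂ) (Ψ : 𝔻 → Matrix ι κ ℂ),
    (∀ p l, IsHolomorphic (fun z => Φ z p l)) ∧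
    (∀ p l, IsHolomorphic (fun z => Ψ z p l)) ∧
    (∀ z, Φ z * Ψ z = 1) ∧ (∀ z, Ψ z * Φ z = 1) ∧
    ∀ (g : MoebiusCover) (v : 𝔻 × (ι → ℂ)),
      E'.act g (v.1, (Φ v.1).mulVec v.2)
        = ((E.act g v).1, (Φ (E.act g v).1).mulVec (E.act g v).2)

/-! ### The elementary bundles -/

/-- A block format: a decomposition of `ℂ^n` into blocks `ℂ^(d 0), …, ℂ^(d m)`, of which the
first and the last one are nonzero. -/
structure BlockFormat where
  m : ℕ
  d : Fin (m + 1) → ℕ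
  first_pos : 0 < d 0
  last_pos : 0 < d (Fin.last m)

/-- The index set of `ℂ^n = ℂ^(d 0) ⊕ ⋯ ⊕ ℂ^(d m)`; `p.1` is the block of the index `p`. -/
abbrev BlockFormat.Idx (s : BlockFormat) : Type := Σ j : Fin (s.m + 1), Fin (s.d j)

/-- The only nonzero blocks of `Y` are those just below the diagonal,
`Y_j : ℂ^(d (j-1)) → ℂ^(d j)`. -/
def BlockFormat.IsSubdiagonal (s : BlockFormat) (Y : Matrix s.Idx s.Idx ℂ) : Prop :=
  ∀ p l : s.Idx, (p.1 : ℕ) ≠ (l.1 : ℕ) + 1 → Y p l = 0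

/-- `A` is block diagonal. -/
def BlockFormat.IsBlockDiagonal (s : BlockFormat) (A : Matrix s.Idx s.Idx ℂ) : Prop :=
  ∀ p l : s.Idx, p.1 ≠ l.1 → A p l = 0

/-- The multiplier `J^(η, Y)`. For `p ≥ l` its block `(p, l)` is
`(1 / (p-l)!) (-c_g)^(p-l) (g'(z))^(η + (p+l)/2) Y_p ⋯ Y_(l+1)`, where `Y_p ⋯ Y_(l+1)` is
the block `(p, l)` of the matrix `Y ^ (p-l)`; for `p < l` it is zero. -/
def multiplier (s : BlockFormat) (η : ℝ) (Y : Matrix s.Idx s.Idx ℂ) (g : MoebiusCover)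
    (z : 𝔻) : Matrix s.Idx s.Idx ℂ :=
  Matrix.of fun p l =>
    if (l.1 : ℕ) ≤ (p.1 : ℕ) then
      1 / (((p.1 : ℕ) - (l.1 : ℕ)).factorial : ℂ) * (-g.c) ^ ((p.1 : ℕ) - (l.1 : ℕ)) *
        g.derivPow (η + (((p.1 : ℕ) : ℝ) + ((l.1 : ℕ) : ℝ)) / 2) z *
        (Y ^ ((p.1 : ℕ) - (l.1 : ℕ))) p l
    else 0

theorem BlockFormat.IsSubdiagonal.pow_eq_zero {s : BlockFormat} {Y : Matrix s.Idx s.Idx ℂ}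
    (hY : s.IsSubdiagonal Y) (n : ℕ) (p l : s.Idx) (h : (p.1 : ℕ) ≠ (l.1 : ℕ) + n) :
    (Y ^ n) p l = 0 := by
  induction n generalizing p with
  | zero =>
    rw [pow_zero, Matrix.one_apply_ne]
    rintro rfl
    exact h rfl
  | succ n ih =>
    rw [pow_succ', Matrix.mul_apply]
    refine Finset.sum_eq_zero fun k _ => ?_
    by_cases hk : (k.1 : ℕ) = (l.1 : ℕ) + n
    · rw [hY p k (by omega), zero_mul]
    · rw [ih k hk, mul_zero]

theorem MoebiusCover.c_mul_eq (g h : MoebiusCover) (z : 𝔻) :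
    (g * h).c = h.c * exp (g.log (h.app z)) + g.c * exp (-h.log z) := by
  have h0 := h.den_ne_zero z
  rw [Complex.exp_neg, g.exp_log, h.exp_log, MoebiusCover.coe_app, MoebiusCover.mul_c]
  field_simp
  linear_combination g.c * h.det_eq

theorem multiplier_coeff (η : ℝ) (g h : MoebiusCover) (z : 𝔻) (l n : ℕ) :
    ∑ t ∈ Finset.range (n + 1),
      (1 / ((n - t).factorial : ℂ) * (-h.c) ^ (n - t) *
        h.derivPow (η + (((l + n : ℕ) : ℝ) + ((l + t : ℕ) : ℝ)) / 2) z) *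
      (1 / (t.factorial : ℂ) * (-g.c) ^ t *
        g.derivPow (η + (((l + t : ℕ) : ℝ) + (l : ℝ)) / 2) (h.app z))
    = 1 / (n.factorial : ℂ) * (-(g * h).c) ^ n *
        (g * h).derivPow (η + (((l + n : ℕ) : ℝ) + (l : ℝ)) / 2) z := by
  have e : -(g * h).c = (-g.c) * exp (-h.log z) + (-h.c) * exp (g.log (h.app z)) := by
    rw [g.c_mul_eq h z]; ring
  rw [e, add_pow, Finset.mul_sum, Finset.sum_mul]
  refine Finset.sum_congr rfl fun t ht => ?_
  have htn : t ≤ n := Nat.lt_succ_iff.1 (Finset.mem_range.1 ht)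
  obtain ⟨r, rfl⟩ := Nat.exists_eq_add_of_le htn
  have hc : ((t + r).choose t : ℂ) = ((t + r).factorial : ℂ) / (t.factorial * r.factorial) := by
    rw [Nat.cast_choose ℂ (Nat.le_add_right t r), Nat.add_sub_cancel_left]
  rw [Nat.add_sub_cancel_left, hc, mul_pow, mul_pow, ← Complex.exp_nat_mul,
    ← Complex.exp_nat_mul]
  have hexp : h.derivPow (η + (((l + (t + r) : ℕ) : ℝ) + ((l + t : ℕ) : ℝ)) / 2) z *
        g.derivPow (η + (((l + t : ℕ) : ℝ) + (l : ℝ)) / 2) (h.app z)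
      = exp (t * -h.log z) * exp (r * g.log (h.app z)) *
        (g * h).derivPow (η + (((l + (t + r) : ℕ) : ℝ) + (l : ℝ)) / 2) z := by
    simp only [MoebiusCover.derivPow, MoebiusCover.mul_log, ← Complex.exp_add]
    congr 1
    push_cast
    ring
  have f1 : ((t + r).factorial : ℂ) ≠ 0 := by exact_mod_cast (t + r).factorial_ne_zero
  have f2 : (t.factorial : ℂ) ≠ 0 := by exact_mod_cast t.factorial_ne_zero
  have f3 : (r.factorial : ℂ) ≠ 0 := by exact_mod_cast r.factorial_ne_zero
  calc _ = 1 / (r.factorial : ℂ) * (1 / (t.factorial : ℂ)) * (-h.c) ^ r * (-g.c) ^ t *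
        (h.derivPow (η + (((l + (t + r) : ℕ) : ℝ) + ((l + t : ℕ) : ℝ)) / 2) z *
        g.derivPow (η + (((l + t : ℕ) : ℝ) + (l : ℝ)) / 2) (h.app z)) := by ring
    _ = _ := by
      rw [hexp]
      field_simp

theorem multiplier_one (s : BlockFormat) (η : ℝ) (Y : Matrix s.Idx s.Idx ℂ) (z : 𝔻) :
    multiplier s η Y 1 z = 1 := by
  ext p l
  have hd : ∀ x, (1 : MoebiusCover).derivPow x z = 1 := by
    intro x
    change exp (-2 * (x : ℂ) * 0) = 1
    simp
  simp only [multiplier, Matrix.of_apply, hd, show (1 : MoebiusCover).c = 0 from rfl, neg_zero]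
  split_ifs with h
  · rcases Nat.eq_zero_or_pos ((p.1 : ℕ) - (l.1 : ℕ)) with h0 | h0
    · simp [h0]
    · rw [zero_pow h0.ne', Matrix.one_apply_ne]
      · simp
      · rintro rfl
        omega
  · rw [Matrix.one_apply_ne]
    rintro rfl
    omega

theorem multiplier_mul (s : BlockFormat) (η : ℝ) (Y : Matrix s.Idx s.Idx ℂ)
    (hY : s.IsSubdiagonal Y) (g h : MoebiusCover) (z : 𝔻) :
    multiplier s η Y (g * h) z = multiplier s η Y h z * multiplier s η Y g (h • z) := by
  ext p l
  rw [Matrix.mul_apply]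
  by_cases hpl : (l.1 : ℕ) ≤ (p.1 : ℕ)
  · obtain ⟨n, hn⟩ := Nat.exists_eq_add_of_le hpl
    have lhs : multiplier s η Y (g * h) z p l = (1 / (n.factorial : ℂ) * (-(g * h).c) ^ n *
        (g * h).derivPow (η + ((((l.1 : ℕ) + n : ℕ) : ℝ) + ((l.1 : ℕ) : ℝ)) / 2) z) *
        (Y ^ n) p l := by
      simp only [multiplier, Matrix.of_apply]
      rw [if_pos hpl, hn, Nat.add_sub_cancel_left]
    rw [lhs, ← multiplier_coeff, Finset.sum_mul]
    have step : ∀ t ∈ Finset.range (n + 1), (Y ^ n) p l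
        = ∑ k : s.Idx, (Y ^ (n - t)) p k * (Y ^ t) k l := by
      intro t ht
      rw [← Matrix.mul_apply, ← pow_add,
        Nat.sub_add_cancel (Nat.lt_succ_iff.1 (Finset.mem_range.1 ht))]
    rw [Finset.sum_congr rfl fun t ht => by rw [step t ht, Finset.mul_sum], Finset.sum_comm]
    refine Finset.sum_congr rfl fun k _ => ?_
    by_cases hk : (l.1 : ℕ) ≤ (k.1 : ℕ) ∧ (k.1 : ℕ) ≤ (p.1 : ℕ)
    · obtain ⟨r, hr⟩ := Nat.exists_eq_add_of_le hk.1
      rw [Finset.sum_eq_single r]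
      · simp only [multiplier, Matrix.of_apply]
        rw [if_pos hk.2, if_pos hk.1, hr, Nat.add_sub_cancel_left, hn, Nat.add_sub_add_left]
        change _ = _ * (_ * g.derivPow _ (h.app z) * _)
        ring
      · intro t _ htr
        rw [hY.pow_eq_zero t k l (by omega), mul_zero, mul_zero]
      · intro hr'
        exact absurd (Finset.mem_range.2 (by omega)) hr'
    · rw [Finset.sum_eq_zero]
      · simp only [multiplier, Matrix.of_apply]
        by_cases h1 : (l.1 : ℕ) ≤ (k.1 : ℕ)
        · rw [if_neg (fun h2 => hk ⟨h1, h2⟩), zero_mul]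
        · rw [if_neg h1, mul_zero]
      · intro t ht
        have := Finset.mem_range.1 ht
        rw [hY.pow_eq_zero t k l (by omega), mul_zero, mul_zero]
  · rw [Finset.sum_eq_zero]
    · simp only [multiplier, Matrix.of_apply]
      rw [if_neg hpl]
    · intro k _
      simp only [multiplier, Matrix.of_apply]
      by_cases h1 : (l.1 : ℕ) ≤ (k.1 : ℕ)
      · rw [if_neg (fun h2 => hpl (h1.trans h2)), zero_mul]
      · rw [if_neg h1, mul_zero]

theorem multiplier_holomorphic (s : BlockFormat) (η : ℝ) (Y : Matrix s.Idx s.Idx ℂ)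
    (g : MoebiusCover) (p l : s.Idx) : IsHolomorphic (fun z => multiplier s η Y g z p l) := by
  obtain ⟨F, hF, h⟩ := g.holomorphic_log
  simp only [multiplier, Matrix.of_apply, MoebiusCover.derivPow, h]
  split_ifs
  · exact ⟨_, ((hF.const_mul _).cexp.const_mul _).mul_const _, fun z => rfl⟩
  · exact ⟨fun _ => 0, by fun_prop, fun _ => rfl⟩

theorem multiplier_continuous (s : BlockFormat) (η : ℝ) (Y : Matrix s.Idx s.Idx ℂ) :
    Continuous (fun q : MoebiusCover × 𝔻 => multiplier s η Y q.1 q.2) := by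
  refine continuous_matrix fun p l => ?_
  simp only [multiplier, Matrix.of_apply, MoebiusCover.derivPow]
  have h1 := MoebiusCover.continuous_c
  have h2 := MoebiusCover.continuous_log
  split_ifs
  · fun_prop
  · exact continuous_const

/-- The elementary homogeneous holomorphic vector bundle `E^(η, Y)`, in its natural
trivialization. -/
def elementaryBundle (s : BlockFormat) (η : ℝ) (Y : Matrix s.Idx s.Idx ℂ)
    (hY : s.IsSubdiagonal Y) : HomogeneousBundle s.Idx where
  J := multiplier s η Y
  holomorphic := multiplier_holomorphic s η Y
  continuous := multiplier_continuous s η Y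
  J_one := multiplier_one s η Y
  J_mul := multiplier_mul s η Y hY

end DiscBundle

end

open Complex
open scoped ComplexConjugate Complex.UnitDisc

/-! An isomorphism is a holomorphic matrix function `Φ` with `Φ z * J g z = J' g z * Φ (g • z)`,
hence it is determined by `Φ 0`. Two subsets of the group carry all the information.

The rotations fix the origin and act on the fibre there diagonally, with weight `η + j` on block `j`
(`multiplier_rotation`). So `Φ 0` matches equal weights (`weight_eq_of_equivariant`), and the
multiplicities of the weights recover `η` and the format, because the first and last blocks are
nonzero.

For equal formats and equal `η`, `A = Φ 0` is therefore block diagonal. Moving the origin to `z`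
makes the first subdiagonal blocks of `Φ z` equal to those of `Y' * A - A * Y` times `conj z / (1 -
|z|²)` (`multiplier_inv_mul_mul_multiplier`). That factor is not holomorphic, so `Y' * A = A * Y`.
Conversely, such an `A`, taken as a constant bundle map, is equivariant. -/

namespace DiscBundle

/-! ### Rotations and transitivity of the action -/

namespace MoebiusCover

/-- The rotation `z ↦ e^(-2iθ) z`, with the branch `log = iθ`. -/
noncomputable def rotation (θ : ℝ) : MoebiusCover where
  c := 0
  d := exp (θ * I)
  log := fun _ => θ * I
  det_eq_one := by
    rw [normSq_eq_norm_sq, norm_exp_ofReal_mul_I]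
    simp
  holomorphic_log := ⟨fun _ => θ * I, by fun_prop, fun _ => rfl⟩
  exp_log := by simp

theorem rotation_smul_zero (θ : ℝ) : rotation θ • (0 : 𝔻) = 0 := by
  apply UnitDisc.coe_injective
  change ((rotation θ).app 0 : ℂ) = _
  rw [coe_app]
  simp [rotation]

/-- The group acts transitively: the origin can be moved to any `z` by an element with
`c d = conj z / (1 - |z|²)`. -/
theorem exists_smul_zero_eq (z : 𝔻) :
    ∃ g : MoebiusCover, g • (0 : 𝔻) = z ∧
      g.c * g.d * (1 - normSq (z : ℂ)) = conj (z : ℂ) := by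
  have hz : 0 < 1 - normSq (z : ℂ) := sub_pos.2 z.normSq_lt_one
  set r : ℝ := (Real.sqrt (1 - normSq (z : ℂ)))⁻¹ with hr
  have hr0 : 0 < r := inv_pos.2 (Real.sqrt_pos.2 hz)
  have hr2 : r * r * (1 - normSq (z : ℂ)) = 1 := by
    rw [hr, ← mul_inv, Real.mul_self_sqrt hz.le, inv_mul_cancel₀ hz.ne']
  -- The denominator is `r (conj z w + 1)` with positive real part, so the principal logarithm is a
  -- holomorphic branch on the whole disc.
  have hslit : ∀ w : ℂ, ‖w‖ < 1 → conj (z : ℂ) * r * w + r ∈ slitPlane := by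
    intro w hw
    left
    have h1 : ‖conj (z : ℂ) * w‖ < 1 := by
      rw [norm_mul, norm_conj]
      exact mul_lt_one_of_nonneg_of_lt_one_left (norm_nonneg _) z.norm_lt_one hw.le
    have h2 : -1 < (conj (z : ℂ) * w).re := by
      have := (abs_lt.1 ((abs_re_le_norm _).trans_lt h1)).1
      exact this
    have h3 : conj (z : ℂ) * r * w + r = (r : ℂ) * (conj (z : ℂ) * w + 1) := by ring
    rw [h3, re_ofReal_mul, add_re, one_re]
    exact mul_pos hr0 (by linarith)
  refine ⟨⟨conj (z : ℂ) * r, r, fun w => Complex.log (conj (z : ℂ) * r * w + r), ?_,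
    ⟨fun w => Complex.log (conj (z : ℂ) * r * w + r), ?_, fun _ => rfl⟩, ?_⟩, ?_, ?_⟩
  · rw [normSq_mul, normSq_conj, normSq_ofReal]
    linarith
  · intro w hw
    have h1 : DifferentiableAt ℂ (fun w : ℂ => conj (z : ℂ) * r * w + r) w := by fun_prop
    exact (h1.clog (hslit w (by simpa using hw))).differentiableWithinAt
  · intro w
    exact Complex.exp_log (slitPlane_ne_zero (hslit w w.norm_lt_one))
  · apply UnitDisc.coe_injective
    change (app _ _ : ℂ) = _
    rw [coe_app]
    have : (r : ℂ) ≠ 0 := by exact_mod_cast hr0.ne'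
    simp [this]
  · have : (r : ℂ) * r * (1 - normSq (z : ℂ)) = 1 := by exact_mod_cast hr2
    change conj (z : ℂ) * r * r * _ = _
    linear_combination conj (z : ℂ) * this

theorem log_inv_smul (g : MoebiusCover) (z : 𝔻) : g⁻¹.log (g • z) = -g.log z := by
  have h : (g⁻¹ * g).log z = 0 := by rw [inv_mul_cancel]; rfl
  rw [mul_log] at h
  exact eq_neg_of_add_eq_zero_left h

end MoebiusCover

/-! ### The obstruction to holomorphy -/

/-- No nonzero multiple of `conj z / (1 - |z|²)` is holomorphic on the disc. -/
theorem IsHolomorphic.eq_zero_of_mul_eq_conj {f : 𝔻 → ℂ} (hf : IsHolomorphic f) {a : ℂ}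
    (h : ∀ z : 𝔻, f z * (1 - normSq (z : ℂ)) = conj (z : ℂ) * a) : a = 0 := by
  obtain ⟨F, hF, hfF⟩ := hf
  have hd : HasDerivAt F (deriv F 0) 0 :=
    (hF.differentiableAt (Metric.ball_mem_nhds 0 one_pos)).hasDerivAt
  have hF0 : ∀ z : ℂ, ‖z‖ < 1 → F z * (1 - normSq z) = conj z * a := by
    intro z hz
    have := h (UnitDisc.mk z hz)
    rwa [hfF, UnitDisc.coe_mk] at this
  -- Differentiating at `t = 0` along `t ↦ t u` compares a complex linear map with an antilinear
  -- one; the directions `1` and `I` then give `F'(0) = a` and `F'(0) = -a`.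
  have line : ∀ u : ℂ, normSq u = 1 → u * deriv F 0 = conj u * a := by
    intro u hu
    have h1 : HasDerivAt (fun t : ℝ => (t : ℂ) * u) u 0 := by
      simpa using (ofRealCLM.hasDerivAt (x := (0 : ℝ))).mul_const u
    have h2 : HasDerivAt (fun t : ℝ => F ((t : ℂ) * u)) (deriv F 0 * u) 0 := by
      have hd' : HasDerivAt F (deriv F 0) (((0 : ℝ) : ℂ) * u) := by simpa using hd
      exact hd'.comp (0 : ℝ) h1
    have h3 : HasDerivAt (fun t : ℝ => (1 - (t : ℂ) * t)) 0 0 := by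
      have := (ofRealCLM.hasDerivAt (x := (0 : ℝ)))
      simpa using (this.mul this).const_sub 1
    have h4 := h2.mul h3
    have h5 : HasDerivAt (fun t : ℝ => (t : ℂ) * (conj u * a)) (conj u * a) 0 := by
      simpa using (ofRealCLM.hasDerivAt (x := (0 : ℝ))).mul_const (conj u * a)
    have hev : (fun t : ℝ => (t : ℂ) * (conj u * a)) =ᶠ[nhds 0]
        (fun t : ℝ => F ((t : ℂ) * u)) * (fun t : ℝ => (1 - (t : ℂ) * t)) := by
      filter_upwards [Metric.ball_mem_nhds (0 : ℝ) one_pos] with t ht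
      have hun : ‖u‖ = 1 := by
        rw [normSq_eq_norm_sq] at hu
        exact (pow_eq_one_iff_of_nonneg (norm_nonneg _) two_ne_zero).1 hu
      have := hF0 (t * u) (by rw [norm_mul, hun, mul_one]; simpa using ht)
      rw [normSq_mul, hu, normSq_ofReal, map_mul, conj_ofReal] at this
      push_cast at this
      rw [Pi.mul_apply]
      linear_combination -this
    have := (h4.congr_of_eventuallyEq hev).unique h5
    simpa [mul_comm] using this
  have e1 := line 1 (by simp)
  have e2 := line I (by simp)
  simp only [map_one, one_mul, conj_I] at e1 e2
  have : I * a = 0 := by linear_combination (1 / 2 : ℂ) * e2 - (I / 2) * e1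
  simpa [I_ne_zero] using this

/-! ### Equivariance as a matrix identity -/

section Equivariance

variable {ι κ : Type} [Fintype ι] [DecidableEq ι] [Fintype κ] [DecidableEq κ]

/-- The action of `g⁻¹` carries the fibre over `g • z` to the fibre over `z` by `J g z`;
equivariance under `g⁻¹` is tested there on basis vectors. -/
theorem HomogeneousBundle.mul_J_eq_of_act {E : HomogeneousBundle ι} {E' : HomogeneousBundle κ}
    {Φ : 𝔻 → Matrix κ ι ℂ}
    (h : ∀ (g : MoebiusCover) (v : 𝔻 × (ι → ℂ)),
      E'.act g (v.1, (Φ v.1).mulVec v.2)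
        = ((E.act g v).1, (Φ (E.act g v).1).mulVec (E.act g v).2))
    (g : MoebiusCover) (z : 𝔻) : Φ z * E.J g z = E'.J g z * Φ (g • z) := by
  apply Matrix.ext_of_mulVec_single
  intro i
  have := congrArg Prod.snd (h g⁻¹ (g • z, Pi.single i 1))
  simp only [act, inv_smul_smul, inv_inv, Matrix.mulVec_mulVec] at this
  exact this.symm

theorem HomogeneousBundle.J_inv_mul (E : HomogeneousBundle ι) (g : MoebiusCover) (z : 𝔻) :
    E.J g⁻¹ (g • z) * E.J g z = 1 := by
  have := E.J_mul g g⁻¹ (g • z)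
  rwa [mul_inv_cancel, E.J_one, inv_smul_smul, eq_comm] at this

end Equivariance

/-! ### Blocks of the multiplier on and next to the diagonal -/

section Multiplier

variable {s : BlockFormat}

theorem multiplier_of_block_eq (η : ℝ) (Y : Matrix s.Idx s.Idx ℂ) (g : MoebiusCover) (z : 𝔻)
    {p l : s.Idx} (h : (p.1 : ℕ) = l.1) :
    multiplier s η Y g z p l = g.derivPow (η + ((l.1 : ℕ) : ℝ)) z * (1 : Matrix s.Idx s.Idx ℂ) p l
    := by
  have h' : ¬ p.1 < l.1 := by rw [Fin.lt_def]; omega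
  simp [multiplier, h, h']

theorem multiplier_of_block_eq_succ (η : ℝ) (Y : Matrix s.Idx s.Idx ℂ) (g : MoebiusCover)
    (z : 𝔻) {p l : s.Idx} (h : (p.1 : ℕ) = l.1 + 1) :
    multiplier s η Y g z p l
      = -g.c * g.derivPow (η + ((l.1 : ℕ) : ℝ) + 1 / 2) z * Y p l := by
  have : η + (((l.1 : ℕ) : ℝ) + 1 + ((l.1 : ℕ) : ℝ)) / 2 = η + ((l.1 : ℕ) : ℝ) + 1 / 2 := by ring
  have h' : ¬ p.1 < l.1 := by rw [Fin.lt_def]; omega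
  simp [multiplier, h, h', this]

theorem multiplier_of_block_lt (η : ℝ) (Y : Matrix s.Idx s.Idx ℂ) (g : MoebiusCover) (z : 𝔻)
    {p l : s.Idx} (h : (p.1 : ℕ) < l.1) : multiplier s η Y g z p l = 0 := by
  simp only [multiplier, Matrix.of_apply]
  rw [if_neg (not_le.2 h)]

/-- Since `c = 0`, every block below the diagonal vanishes, and the stabilizer of the origin acts on
block `j` by a single character. -/
theorem multiplier_rotation (η : ℝ) (Y : Matrix s.Idx s.Idx ℂ) (θ : ℝ) (z : 𝔻) :
    multiplier s η Y (MoebiusCover.rotation θ) z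
      = Matrix.diagonal fun p : s.Idx => exp (-2 * ((η + (p.1 : ℕ) : ℝ) : ℂ) * (θ * I)) := by
  ext p l
  rcases lt_trichotomy (p.1 : ℕ) (l.1 : ℕ) with h | h | h
  · rw [multiplier_of_block_lt _ _ _ _ h, Matrix.diagonal_apply_ne]
    rintro rfl
    exact h.false
  · rw [multiplier_of_block_eq _ _ _ _ h]
    by_cases hpl : p = l
    · subst hpl
      simp [MoebiusCover.derivPow, MoebiusCover.rotation]
    · simp [hpl]
  · rw [Matrix.diagonal_apply_ne]
    · have : (p.1 : ℕ) - (l.1 : ℕ) ≠ 0 := by omega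
      simp [multiplier, MoebiusCover.rotation, this]
    · rintro rfl
      exact h.false

/-- The first subdiagonal blocks of a bundle map, transported from the origin by `g`. -/
theorem multiplier_inv_mul_mul_multiplier {η : ℝ} {Y Y' A : Matrix s.Idx s.Idx ℂ}
    (hY : s.IsSubdiagonal Y) (hY' : s.IsSubdiagonal Y') (hA : s.IsBlockDiagonal A)
    (g : MoebiusCover) {p l : s.Idx} (h : (p.1 : ℕ) = l.1 + 1) :
    (multiplier s η Y' g⁻¹ (g • 0) * A * multiplier s η Y g 0) p l
      = g.c * g.d * (Y' * A - A * Y) p l := by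
  have hd : g.d = exp (g.log 0) := by rw [g.exp_log]; simp
  -- Both multipliers are block lower triangular and `A` preserves blocks, so a term survives only
  -- if `k` and `k'` both lie in the block of `l` (contributing `Y'`) or both in that of `p`
  -- (contributing `Y`). The opposite signs come from `g⁻¹.c = -g.c`.
  have key : ∀ k' k : s.Idx, multiplier s η Y' g⁻¹ (g • 0) p k * A k k' * multiplier s η Y g 0 k' l
      = g.c * g.d * (Y' p k * A k k' * (1 : Matrix s.Idx s.Idx ℂ) k' l
        - (1 : Matrix s.Idx s.Idx ℂ) p k * A k k' * Y k' l) := by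
    intro k' k
    by_cases hkk : k.1 = k'.1
    swap
    · rw [hA k k' hkk]; ring
    have hkk' : (k.1 : ℕ) = k'.1 := congrArg Fin.val hkk
    by_cases h1 : (k.1 : ℕ) = l.1
    · rw [multiplier_of_block_eq_succ _ _ _ _ (show (p.1 : ℕ) = k.1 + 1 by omega),
        multiplier_of_block_eq _ _ _ _ (show (k'.1 : ℕ) = l.1 by omega),
        hY k' l (by omega), mul_zero, sub_zero, MoebiusCover.inv_c, neg_neg, h1, hd]
      -- The branches at `g • 0` and `0` are opposite and the exponents differ by `1 / 2`, which
      -- leaves exactly one factor `exp (g.log 0) = g.d`.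
      have e : g⁻¹.derivPow (η + ((l.1 : ℕ) : ℝ) + 1 / 2) (g • 0) *
          g.derivPow (η + ((l.1 : ℕ) : ℝ)) 0 = exp (g.log 0) := by
        rw [MoebiusCover.derivPow, MoebiusCover.derivPow, MoebiusCover.log_inv_smul,
          ← Complex.exp_add]
        congr 1
        push_cast
        ring
      rw [← e]
      ring
    by_cases h2 : (k.1 : ℕ) = p.1
    · rw [multiplier_of_block_eq _ _ _ _ h2.symm,
        multiplier_of_block_eq_succ _ _ _ _ (show (k'.1 : ℕ) = l.1 + 1 by omega),
        hY' p k (by omega), zero_mul, zero_mul, zero_sub, hd, h2, h]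
      have e : g⁻¹.derivPow (η + (((l.1 : ℕ) + 1 : ℕ) : ℝ)) (g • 0) *
          g.derivPow (η + ((l.1 : ℕ) : ℝ) + 1 / 2) 0 = exp (g.log 0) := by
        rw [MoebiusCover.derivPow, MoebiusCover.derivPow, MoebiusCover.log_inv_smul,
          ← Complex.exp_add]
        congr 1
        push_cast
        ring
      rw [← e]
      ring
    have hpk : p ≠ k := by rintro rfl; exact h2 rfl
    rw [hY' p k (by omega), Matrix.one_apply_ne hpk]
    rcases lt_or_ge (k.1 : ℕ) (l.1 : ℕ) with h3 | h3
    · rw [multiplier_of_block_lt _ _ _ _ (show (k'.1 : ℕ) < l.1 by omega)]; ring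
    · rw [multiplier_of_block_lt _ _ _ _ (show (p.1 : ℕ) < k.1 by omega)]; ring
  -- The inserted identities give both products the double-sum shape of `key`.
  have e : Y' * A - A * Y = Y' * A * 1 - 1 * A * Y := by simp
  rw [e, Matrix.sub_apply]
  simp only [Matrix.mul_apply (M := _ * _), Matrix.mul_apply (M := Y') (N := A),
    Matrix.mul_apply (M := (1 : Matrix s.Idx s.Idx ℂ)) (N := A),
    Matrix.mul_apply (M := multiplier s η Y' g⁻¹ (g • 0)) (N := A), Finset.sum_mul]
  rw [← Finset.sum_sub_distrib, Finset.mul_sum]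
  refine Finset.sum_congr rfl fun k' _ => ?_
  rw [← Finset.sum_sub_distrib, Finset.mul_sum]
  exact Finset.sum_congr rfl fun k _ => key k' k

/-- A block diagonal matrix intertwining `Y` and `Y'` intertwines the multipliers. -/
theorem BlockFormat.IsBlockDiagonal.mul_multiplier {A : Matrix s.Idx s.Idx ℂ}
    (hA : s.IsBlockDiagonal A) {Y Y' : Matrix s.Idx s.Idx ℂ} (h : Y' * A = A * Y) (η : ℝ)
    (g : MoebiusCover) (z : 𝔻) :
    A * multiplier s η Y g z = multiplier s η Y' g z * A := by
  have hpow : ∀ n : ℕ, Y' ^ n * A = A * Y ^ n := fun n =>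
    ((show SemiconjBy A Y Y' from h.symm).pow_right n).eq.symm
  ext p l
  -- The scalar factor depends only on the blocks of `p` and `l`, which `A` preserves, so only `Y' ^
  -- n * A = A * Y ^ n` matters.
  set C : ℂ := if (l.1 : ℕ) ≤ (p.1 : ℕ) then
    1 / (((p.1 : ℕ) - (l.1 : ℕ)).factorial : ℂ) * (-g.c) ^ ((p.1 : ℕ) - (l.1 : ℕ)) *
      g.derivPow (η + (((p.1 : ℕ) : ℝ) + ((l.1 : ℕ) : ℝ)) / 2) z else 0 with hC
  trans C * (A * Y ^ ((p.1 : ℕ) - (l.1 : ℕ))) p l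
  · rw [Matrix.mul_apply, Matrix.mul_apply, Finset.mul_sum]
    refine Finset.sum_congr rfl fun k _ => ?_
    by_cases hk : p.1 = k.1
    · simp only [multiplier, Matrix.of_apply, hC, hk]
      split_ifs <;> ring
    · simp [hA p k hk]
  · rw [← hpow, Matrix.mul_apply, Matrix.mul_apply, Finset.mul_sum]
    refine Finset.sum_congr rfl fun k _ => ?_
    by_cases hk : k.1 = l.1
    · simp only [multiplier, Matrix.of_apply, hC, hk]
      split_ifs <;> ring
    · simp [hA k l hk]

end Multiplier

/-! ### Weights at the origin and the block format -/

/-- In the covering group the rotations form a line rather than a circle, so a character determines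
its real weight exactly. -/
theorem eq_of_forall_exp_eq {x y : ℝ}
    (h : ∀ θ : ℝ, exp (-2 * (x : ℂ) * (θ * I)) = exp (-2 * (y : ℂ) * (θ * I))) : x = y := by
  by_contra hxy
  have hxy' : (x : ℂ) - y ≠ 0 := by exact_mod_cast sub_ne_zero.2 hxy
  -- At this angle the two exponents differ by `π * I`, so the exponentials are opposite.
  have h1 := h (Real.pi / (2 * (y - x)))
  have e : -2 * (x : ℂ) * (((Real.pi / (2 * (y - x)) : ℝ) : ℂ) * I)
      = -2 * (y : ℂ) * (((Real.pi / (2 * (y - x)) : ℝ) : ℂ) * I) + Real.pi * I := by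
    have : (y : ℂ) - x ≠ 0 := by rw [← neg_sub]; exact neg_ne_zero.2 hxy'
    push_cast
    field_simp
    ring
  rw [e, Complex.exp_add, exp_pi_mul_I] at h1
  have h2 := Complex.exp_ne_zero (-2 * (y : ℂ) * (((Real.pi / (2 * (y - x)) : ℝ) : ℂ) * I))
  apply h2
  linear_combination (-1 / 2 : ℂ) * h1

/-- Mutually inverse matrices which respect gradings of the index sets force the graded pieces
to have equal size. -/
theorem card_filter_eq_of_mul_eq_one {ι κ α : Type*} [Fintype ι] [Fintype κ] [DecidableEq ι]
    [DecidableEq κ] [DecidableEq α] {Φ : Matrix κ ι ℂ} {Ψ : Matrix ι κ ℂ} (h1 : Φ * Ψ = 1)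
    (h2 : Ψ * Φ = 1) (u : ι → α) (v : κ → α) (h : ∀ p l, Φ p l ≠ 0 → u l = v p) (w : α) :
    (Finset.univ.filter fun l => u l = w).card = (Finset.univ.filter fun p => v p = w).card := by
  -- Both cardinalities are partial traces, of `Ψ * Φ` and of `Φ * Ψ`. They agree term by term,
  -- since a nonzero `Φ p l` forces equal grades.
  have e1 : ((Finset.univ.filter fun l => u l = w).card : ℂ)
      = ∑ l, ∑ p, if u l = w then Ψ l p * Φ p l else 0 := by
    rw [Finset.card_filter]
    push_cast
    refine Finset.sum_congr rfl fun l _ => ?_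
    split_ifs
    · rw [← Matrix.mul_apply, h2, Matrix.one_apply_eq]
    · simp
  have e2 : ((Finset.univ.filter fun p => v p = w).card : ℂ)
      = ∑ p, ∑ l, if v p = w then Φ p l * Ψ l p else 0 := by
    rw [Finset.card_filter]
    push_cast
    refine Finset.sum_congr rfl fun p _ => ?_
    split_ifs
    · rw [← Matrix.mul_apply, h1, Matrix.one_apply_eq]
    · simp
  have : ((Finset.univ.filter fun l => u l = w).card : ℂ)
      = ((Finset.univ.filter fun p => v p = w).card : ℂ) := by
    rw [e1, e2, Finset.sum_comm]
    refine Finset.sum_congr rfl fun p _ => Finset.sum_congr rfl fun l _ => ?_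
    by_cases h0 : Φ p l = 0
    · simp [h0]
    · rw [h p l h0, mul_comm]
  exact_mod_cast this

theorem BlockFormat.card_filter_block (s : BlockFormat) (j : Fin (s.m + 1)) :
    (Finset.univ.filter fun p : s.Idx => p.1 = j).card = s.d j := by
  rw [Finset.card_filter, Fintype.sum_sigma, Finset.sum_eq_single j]
  · simp
  · intro b _ hb
    simp [hb]
  · simp

/-- The weights `η + j`, counted with multiplicity `d j`, determine `η` and the format. -/
theorem BlockFormat.eq_of_card_weight_eq {s s' : BlockFormat} {η η' : ℝ}
    (h : ∀ w : ℝ, (Finset.univ.filter fun p : s.Idx => η + ((p.1 : ℕ) : ℝ) = w).card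
      = (Finset.univ.filter fun p : s'.Idx => η' + ((p.1 : ℕ) : ℝ) = w).card) :
    η = η' ∧ s = s' := by
  have aux : ∀ {s s' : BlockFormat} {η η' : ℝ},
      (∀ w : ℝ, (Finset.univ.filter fun p : s.Idx => η + ((p.1 : ℕ) : ℝ) = w).card
        = (Finset.univ.filter fun p : s'.Idx => η' + ((p.1 : ℕ) : ℝ) = w).card) →
      ∀ j : Fin (s.m + 1), 0 < s.d j →
        ∃ k : Fin (s'.m + 1), η' + ((k : ℕ) : ℝ) = η + ((j : ℕ) : ℝ) := by
    intro s s' η η' h j hj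
    have hpos : 0 < (Finset.univ.filter fun p : s.Idx =>
        η + ((p.1 : ℕ) : ℝ) = η + ((j : ℕ) : ℝ)).card :=
      Finset.card_pos.2 ⟨⟨j, ⟨0, hj⟩⟩, by simp⟩
    rw [h] at hpos
    obtain ⟨q, hq⟩ := Finset.card_pos.1 hpos
    exact ⟨q.1, (Finset.mem_filter.1 hq).2⟩
  -- The first block is nonempty, so `η` and `η'` are the least weights of the two sides, and each
  -- is at least the other. The last block settles `m` in the same way.
  have hη : η = η' := by
    obtain ⟨k, hk⟩ := aux h 0 s.first_pos
    obtain ⟨k', hk'⟩ := aux (fun w => (h w).symm) 0 s'.first_pos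
    have := Nat.cast_nonneg (α := ℝ) (k : ℕ)
    have := Nat.cast_nonneg (α := ℝ) (k' : ℕ)
    simp only [Fin.val_zero, Nat.cast_zero, add_zero] at hk hk'
    linarith
  subst hη
  refine ⟨rfl, ?_⟩
  have hm : s.m = s'.m := by
    obtain ⟨k, hk⟩ := aux h (Fin.last _) s.last_pos
    obtain ⟨k', hk'⟩ := aux (fun w => (h w).symm) (Fin.last _) s'.last_pos
    have h1 : (k : ℕ) = s.m := by simpa using hk
    have h2 : (k' : ℕ) = s'.m := by simpa using hk'
    omega
  have hd : ∀ (j : Fin (s.m + 1)) (k : Fin (s'.m + 1)), (j : ℕ) = k → s.d j = s'.d k := by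
    intro j k hjk
    rw [← s.card_filter_block, ← s'.card_filter_block]
    convert h (η + ((j : ℕ) : ℝ)) using 4
    · simp [Fin.ext_iff]
    · simp [Fin.ext_iff, hjk]
  obtain ⟨m, d, _, _⟩ := s
  obtain ⟨m', d', _, _⟩ := s'
  obtain rfl : m = m' := hm
  obtain rfl : d = d' := funext fun j => hd j j rfl
  rfl

/-- The value at the origin of an equivariant bundle map respects the weights `η + j`. -/
theorem weight_eq_of_equivariant {s s' : BlockFormat} {η η' : ℝ} {Y : Matrix s.Idx s.Idx ℂ}
    {Y' : Matrix s'.Idx s'.Idx ℂ} {Φ : 𝔻 → Matrix s'.Idx s.Idx ℂ}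
    (h : ∀ g z, Φ z * multiplier s η Y g z = multiplier s' η' Y' g z * Φ (g • z))
    (p : s'.Idx) (l : s.Idx) (hpl : Φ 0 p l ≠ 0) :
    η + ((l.1 : ℕ) : ℝ) = η' + ((p.1 : ℕ) : ℝ) := by
  refine eq_of_forall_exp_eq fun θ => ?_
  -- Rotations fix the origin, so `Φ 0` intertwines two diagonal matrices.
  have := congrFun (congrFun (h (MoebiusCover.rotation θ) 0) p) l
  rw [MoebiusCover.rotation_smul_zero, multiplier_rotation, multiplier_rotation,
    Matrix.mul_diagonal, Matrix.diagonal_mul, mul_comm] at this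
  exact mul_right_cancel₀ hpl this

/-! ### The classification -/

theorem eq_of_isomorphic {s s' : BlockFormat} {η η' : ℝ} {Y : Matrix s.Idx s.Idx ℂ}
    {hY : s.IsSubdiagonal Y} {Y' : Matrix s'.Idx s'.Idx ℂ} {hY' : s'.IsSubdiagonal Y'}
    (h : (elementaryBundle s η Y hY).Isomorphic (elementaryBundle s' η' Y' hY')) :
    η = η' ∧ s = s' := by
  obtain ⟨Φ, Ψ, -, -, h1, h2, h⟩ := h
  exact BlockFormat.eq_of_card_weight_eq <| card_filter_eq_of_mul_eq_one (h1 0) (h2 0) _ _ <|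
    weight_eq_of_equivariant (HomogeneousBundle.mul_J_eq_of_act h)

/-- The conjugating matrix is the value `Φ 0`: equal weights make it block diagonal, and holomorphy
of `Φ` makes it intertwine `Y` and `Y'`. -/
theorem exists_conj_of_isomorphic {s : BlockFormat} {η : ℝ} {Y : Matrix s.Idx s.Idx ℂ}
    {hY : s.IsSubdiagonal Y} {Y' : Matrix s.Idx s.Idx ℂ} {hY' : s.IsSubdiagonal Y'}
    (h : (elementaryBundle s η Y hY).Isomorphic (elementaryBundle s η Y' hY')) :
    ∃ A : Matrix s.Idx s.Idx ℂ, s.IsBlockDiagonal A ∧ IsUnit A ∧ Y' = A * Y * A⁻¹ := by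
  obtain ⟨Φ, Ψ, hΦ, -, h1, h2, h⟩ := h
  have hJ : ∀ g z, Φ z * multiplier s η Y g z = multiplier s η Y' g z * Φ (g • z) :=
    HomogeneousBundle.mul_J_eq_of_act h
  have hA : s.IsBlockDiagonal (Φ 0) := by
    intro p l hpl
    by_contra h0
    have := weight_eq_of_equivariant hJ p l h0
    apply hpl
    apply Fin.ext
    have : ((l.1 : ℕ) : ℝ) = ((p.1 : ℕ) : ℝ) := by linarith
    exact_mod_cast this.symm
  have hu : IsUnit (Φ 0) := ⟨⟨Φ 0, Ψ 0, h1 0, h2 0⟩, rfl⟩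
  have hcomm : Y' * Φ 0 = Φ 0 * Y := by
    ext p l
    by_cases hpl : (p.1 : ℕ) = l.1 + 1
    · rw [← sub_eq_zero, ← Matrix.sub_apply]
      refine (hΦ p l).eq_zero_of_mul_eq_conj fun z => ?_
      obtain ⟨g, hg, hcd⟩ := MoebiusCover.exists_smul_zero_eq z
      -- Equivariance propagates the value at the origin to `z = g • 0`.
      have e : Φ z = multiplier s η Y' g⁻¹ (g • 0) * Φ 0 * multiplier s η Y g 0 := by
        have hinv : multiplier s η Y' g⁻¹ (g • 0) * multiplier s η Y' g 0 = 1 :=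
          (elementaryBundle s η Y' hY').J_inv_mul g 0
        rw [Matrix.mul_assoc, hJ, ← Matrix.mul_assoc, hinv, Matrix.one_mul, hg]
      rw [e, multiplier_inv_mul_mul_multiplier hY hY' hA g hpl, ← hcd]
      ring
    -- Off the first subdiagonal both sides vanish: `Y` and `Y'` shift blocks by one and `Φ 0`
    -- preserves them.
    · rw [Matrix.mul_apply, Matrix.mul_apply, Finset.sum_eq_zero, Finset.sum_eq_zero]
      · intro k _
        by_cases hk : p.1 = k.1
        · rw [hY k l (by rw [← hk]; exact hpl), mul_zero]
        · rw [hA p k hk, zero_mul]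
      · intro k _
        by_cases hk : k.1 = l.1
        · rw [hY' p k (by rw [hk]; exact hpl), zero_mul]
        · rw [hA k l hk, mul_zero]
  refine ⟨Φ 0, hA, hu, ?_⟩
  rw [← hcomm, Matrix.mul_assoc, Matrix.mul_nonsing_inv _ ((Matrix.isUnit_iff_isUnit_det _).1 hu),
    Matrix.mul_one]

/-- The isomorphism is constant in the natural trivializations, with inverse `A⁻¹`; equivariance is
`mul_multiplier` applied to `g⁻¹`. -/
theorem isomorphic_of_conj {s : BlockFormat} {η : ℝ} {Y : Matrix s.Idx s.Idx ℂ}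
    {hY : s.IsSubdiagonal Y} {Y' : Matrix s.Idx s.Idx ℂ} {hY' : s.IsSubdiagonal Y'}
    {A : Matrix s.Idx s.Idx ℂ} (hA : s.IsBlockDiagonal A) (hu : IsUnit A)
    (h : Y' = A * Y * A⁻¹) :
    (elementaryBundle s η Y hY).Isomorphic (elementaryBundle s η Y' hY') := by
  have hdet := (Matrix.isUnit_iff_isUnit_det _).1 hu
  have hcomm : Y' * A = A * Y := by
    rw [h, Matrix.mul_assoc, Matrix.nonsing_inv_mul _ hdet, Matrix.mul_one]
  refine ⟨fun _ => A, fun _ => A⁻¹, fun p l => ⟨fun _ => A p l, by fun_prop, fun _ => rfl⟩,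
    fun p l => ⟨fun _ => A⁻¹ p l, by fun_prop, fun _ => rfl⟩,
    fun _ => Matrix.mul_nonsing_inv _ hdet, fun _ => Matrix.nonsing_inv_mul _ hdet, ?_⟩
  intro g v
  refine Prod.ext rfl ?_
  simp only [HomogeneousBundle.act, elementaryBundle, Matrix.mulVec_mulVec,
    hA.mul_multiplier hcomm]

end DiscBundle

theorem mainTheorem3 :
    (∀ (s s' : DiscBundle.BlockFormat) (η η' : ℝ)
      (Y : Matrix s.Idx s.Idx ℂ) (hY : s.IsSubdiagonal Y)
      (Y' : Matrix s'.Idx s'.Idx ℂ) (hY' : s'.IsSubdiagonal Y'),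
      (DiscBundle.elementaryBundle s η Y hY).Isomorphic
        (DiscBundle.elementaryBundle s' η' Y' hY') → s = s') ∧
    (∀ (s : DiscBundle.BlockFormat) (η η' : ℝ)
      (Y : Matrix s.Idx s.Idx ℂ) (hY : s.IsSubdiagonal Y)
      (Y' : Matrix s.Idx s.Idx ℂ) (hY' : s.IsSubdiagonal Y'),
      (DiscBundle.elementaryBundle s η Y hY).Isomorphic
        (DiscBundle.elementaryBundle s η' Y' hY') ↔
      η = η' ∧ ∃ A : Matrix s.Idx s.Idx ℂ,
        s.IsBlockDiagonal A ∧ IsUnit A ∧ Y' = A * Y * A⁻¹) := by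
  refine ⟨fun s s' η η' Y hY Y' hY' h => (DiscBundle.eq_of_isomorphic h).2,
    fun s η η' Y hY Y' hY' => ⟨fun h => ?_, ?_⟩⟩
  · obtain rfl := (DiscBundle.eq_of_isomorphic h).1
    exact ⟨rfl, DiscBundle.exists_conj_of_isomorphic h⟩
  · rintro ⟨rfl, A, hA, hu, h⟩
    exact DiscBundle.isomorphic_of_conj hA hu h
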